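/- For a positive integer $n$, an $n$-arm instance $I$ of Best-$1$-Arm consists of $n$ arms, the $i$-th of which has reward distribution $\mathcal N(\mu_i,1)$ with $\mu_i\in[0,1]$, such that the largest mean is attained by exactly one arm (the best arm). Write $\mu_{[1]}>\mu_{[2]}\ge\dots\ge\mu_{[n]}$ for the means in nonincreasing order and $\Delta_i=\Delta_i(I)=\mu_{[1]}-\mu_{[i]}$. An algorithm is a (possibly randomized) sequential procedure that, knowing $n$ but not the means, on the basis of its internal randomness and of the arms played and rewards observed so far, either plays an arm, obtaining a fresh independent sample of that arm's distribution, or stops and outputs an arm. It is $\delta$-correct if on every instance it stops and outputs the best arm with probability at least $1-\delta$. Let $T_{\mathbb A}[I]\in[0,\infty]$ be the expected total number of samples taken by $\mathbb A$ on $I$ (a run that never stops counts as $\infty$). **Theorem.** There exist constants $c,c_1>0$ and $N\in\mathbb N$ such that for every $\delta\in(0,0.005)$, every $n\ge N$ and every $\delta$-correct algorithm $\mathbb A$ for $n$ arms, there is an $n$-arm instance $I$ with $$T_{\mathbb A}[I]\ \ge\ c\cdot\sum_{i=2}^{n}\Delta_i^{-2}\,\ln\ln n .$$ Furthermore, the same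 instance satisfies $\Delta_2<1$ (so that $\ln\ln\Delta_2^{-1}$ is defined) and $$\Delta_2^{-2}\ln\ln\Delta_2^{-1}\ <\ \frac{c_1}{\ln n}\cdot\sum_{i=2}^{n}\Delta_i^{-2}\,\ln\ln n .$$ -/

import Mathlib

open MeasureTheory ProbabilityTheory
open scoped ENNReal

/-- An instance of the best arm identification problem with `n` Gaussian arms of unit variance:
arm `i` has reward distribution `N(mean i, 1)`, all means lie in `[0, 1]`, and the largest mean is
attained by one arm only. -/
structure BestArmInstance (n : ℕ) where
  /-- the mean of each arm -/
  mean : Fin n → ℝ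
  mean_mem : ∀ i, mean i ∈ Set.Icc (0 : ℝ) 1
  exists_best : ∃ i, ∀ j, j ≠ i → mean j < mean i

namespace BestArmInstance

variable {n : ℕ}

/-- Arm `i` is the best arm (the correct answer) of the instance. -/
def IsBest (I : BestArmInstance n) (i : Fin n) : Prop :=
  ∀ j, j ≠ i → I.mean j < I.mean i

/-- `I.orderedMean i`, for `1 ≤ i ≤ n`, is the `i`-th largest mean, counted with multiplicity.
(`Tuple.sort` sorts in nondecreasing order, with positions `0, …, n - 1`.) -/
noncomputable def orderedMean (I : BestArmInstance n) (i : ℕ) : ℝ :=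
  if h : 1 ≤ i ∧ i ≤ n then I.mean (Tuple.sort I.mean ⟨n - i, by omega⟩) else 0

/-- `I.gap i` is the difference between the largest and the `i`-th largest mean. -/
noncomputable def gap (I : BestArmInstance n) (i : ℕ) : ℝ :=
  I.orderedMean 1 - I.orderedMean i

/-- The joint law of the reward tables `X`, where `X i s` is the reward of the `s`-th play of arm
`i` (`s = 0, 1, …`): all entries are independent and `X i s` has law `N(mean i, 1)`. -/
noncomputable def rewardLaw (I : BestArmInstance n) : Measure (Fin n → ℕ → ℝ) :=
  Measure.pi fun i => Measure.infinitePi fun _ : ℕ => gaussianReal (I.mean i) 1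

end BestArmInstance

/-- A (randomized, sequential) algorithm for best arm identification with `n` arms. Its internal
randomness is a random seed. After `t` plays it sees the seed and the history of those plays, that
is, the arms played and the rewards obtained, and on this basis decides whether to stop; if
it stops, it outputs `recommend t`, otherwise it plays arm `sample t`. -/
structure BestArmAlgorithm (n : ℕ) where
  /-- the values of the internal randomness -/
  Seed : Type*
  [measurableSpaceSeed : MeasurableSpace Seed]
  /-- the law of the internal randomness -/
  seedLaw : Measure Seed
  [isProbabilityMeasure_seedLaw : IsProbabilityMeasure seedLaw]
  /-- the sampling rule -/
  sample : (t : ℕ) → Seed × (Fin t → Fin n × ℝ) → Fin n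
  /-- the stopping rule: the situations after `t` plays in which the algorithm stops -/
  stopSet : (t : ℕ) → Set (Seed × (Fin t → Fin n × ℝ))
  /-- the recommendation rule -/
  recommend : (t : ℕ) → Seed × (Fin t → Fin n × ℝ) → Fin n
  measurable_sample : ∀ t, Measurable (sample t)
  measurableSet_stopSet : ∀ t, MeasurableSet (stopSet t)
  measurable_recommend : ∀ t, Measurable (recommend t)

namespace BestArmAlgorithm

attribute [instance] measurableSpaceSeed isProbabilityMeasure_seedLaw

variable {n : ℕ}

/-- The first `t` plays (arm and reward) made by the sampling rule, on a given seed and a given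
table of rewards; the reward is the next unread entry of the row of the arm played. The stopping
rule is ignored here: plays that come after stopping are not made and never counted below. -/
def history (A : BestArmAlgorithm n) (ω : A.Seed × (Fin n → ℕ → ℝ)) :
    (t : ℕ) → Fin t → Fin n × ℝ
  | 0 => Fin.elim0
  | t + 1 =>
    let h := A.history ω t
    let i := A.sample t (ω.1, h)
    Fin.snoc (α := fun _ => Fin n × ℝ) h (i, ω.2 i (Finset.univ.filter fun k => (h k).1 = i).card)

/-- The stopping rule tells the algorithm to stop after `t` plays. -/
def StopsAt (A : BestArmAlgorithm n) (ω : A.Seed × (Fin n → ℕ → ℝ)) (t : ℕ) : Prop :=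
  (ω.1, A.history ω t) ∈ A.stopSet t

/-- The algorithm stops, and outputs arm `i`. -/
def Returns (A : BestArmAlgorithm n) (ω : A.Seed × (Fin n → ℕ → ℝ)) (i : Fin n) : Prop :=
  ∃ t, A.StopsAt ω t ∧ (∀ s < t, ¬ A.StopsAt ω s) ∧ A.recommend t (ω.1, A.history ω t) = i

/-- The total number of samples: the first time at which the algorithm stops, and `∞` if it never
stops. -/
noncomputable def numSamples (A : BestArmAlgorithm n) (ω : A.Seed × (Fin n → ℕ → ℝ)) : ℝ≥0∞ :=
  ⨅ (t : ℕ) (_ : A.StopsAt ω t), (t : ℝ≥0∞)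

/-- The law of seed and rewards when the algorithm runs on the instance `I`. -/
noncomputable def law (A : BestArmAlgorithm n) (I : BestArmInstance n) :
    Measure (A.Seed × (Fin n → ℕ → ℝ)) :=
  A.seedLaw.prod I.rewardLaw

/-- The expected total number of samples on the instance `I`. -/
noncomputable def expectedSamples (A : BestArmAlgorithm n) (I : BestArmInstance n) : ℝ≥0∞ :=
  ∫⁻ ω, A.numSamples ω ∂(A.law I)

/-- The algorithm is `δ`-correct: on every instance, it returns the best arm with probability at
least `1 - δ`. -/
def IsCorrect (A : BestArmAlgorithm n) (δ : ℝ) : Prop :=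
  ∀ (I : BestArmInstance n) (i : Fin n), I.IsBest i →
    ENNReal.ofReal (1 - δ) ≤ A.law I {ω | A.Returns ω i}

end BestArmAlgorithm

/-! Put arm `z` at mean `1/2` and give every other arm a gap from the geometric scales `D⁻¹, …,
D⁻ᴶ`. The algorithm does not know the scale of an arm, and this costs a factor of order `β ≈ ln ln
n` over the usual `Δ⁻²`. Fix one arm `i` and all other gaps. Let `i` have gap `γ`, and let `x =
γ⁻²`. Stopping with answer `z` after at most `x/4` plays of `i` is unlikely, since raising the mean
of `i` to `1/2 + γ` would make that answer wrong. If fewer than order `βx` plays are expected,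
Markov's inequality then puts the number of plays in a window between a fraction of `x` and `βx`
with probability at least `1/2` (`half_le_real_window`). Moving the mean of `i` to `1/2` changes the
law by a chi-square factor of at most `exp β` on this event, so the window keeps probability at
least `exp (-β) / 4` under a law that is the same for all scales (`exp_le_real_window`). Windows of
different scales are disjoint, so at most `4 exp β` scales are cheap. With `J ≥ 8 exp β`, at least
half are expensive (`sum_plays_ge`). Choosing the scales independently, with weights proportional to
`γ²`, turns these one-arm averages into a single instance on which the total is large
(`exists_sum_le_of_forall_resample`). The parameters keep every `Δ⁻²` below `√n`, while the sum of
the `Δ⁻²` is at least of order `n`. This gives the second claim. -/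

/-! ### Square domination of measures -/

/-- `P` is dominated by `Q` in the chi-square sense, with constant `C`. -/
def SqDominated {Ω : Type*} [MeasurableSpace Ω] (C : ℝ≥0∞) (P Q : Measure Ω) : Prop :=
  ∀ f : Ω → ℝ≥0∞, Measurable f → (∫⁻ ω, f ω ∂P) ^ 2 ≤ C * ∫⁻ ω, f ω ^ 2 ∂Q

theorem sq_lintegral_mul_le {Ω : Type*} [MeasurableSpace Ω] (P : Measure Ω) {f g : Ω → ℝ≥0∞}
    (hf : Measurable f) (hg : Measurable g) :
    (∫⁻ ω, f ω * g ω ∂P) ^ 2 ≤ (∫⁻ ω, g ω ^ 2 ∂P) * ∫⁻ ω, f ω ^ 2 ∂P := by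
  have h := ENNReal.lintegral_mul_le_Lp_mul_Lq P Real.HolderConjugate.two_two
    hf.aemeasurable hg.aemeasurable
  simp only [Pi.mul_apply, ENNReal.rpow_two] at h
  calc (∫⁻ ω, f ω * g ω ∂P) ^ 2
      ≤ ((∫⁻ ω, f ω ^ 2 ∂P) ^ (1 / 2 : ℝ) * (∫⁻ ω, g ω ^ 2 ∂P) ^ (1 / 2 : ℝ)) ^ 2 := by gcongr
    _ = (∫⁻ ω, g ω ^ 2 ∂P) * ∫⁻ ω, f ω ^ 2 ∂P := by
      rw [mul_pow, ← ENNReal.rpow_two, ← ENNReal.rpow_two, ← ENNReal.rpow_mul, ← ENNReal.rpow_mul]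
      norm_num [mul_comm]

namespace SqDominated

variable {Ω Ω' : Type*} [MeasurableSpace Ω] [MeasurableSpace Ω']

theorem refl (P : Measure Ω) [IsProbabilityMeasure P] : SqDominated 1 P P := by
  intro f hf
  simpa using sq_lintegral_mul_le P hf (measurable_const (a := (1 : ℝ≥0∞)))

theorem map {C : ℝ≥0∞} {P Q : Measure Ω} (h : SqDominated C P Q) {φ : Ω → Ω'}
    (hφ : Measurable φ) : SqDominated C (P.map φ) (Q.map φ) := by
  intro f hf
  rw [lintegral_map hf hφ, lintegral_map (hf.pow_const 2) hφ]
  exact h _ (hf.comp hφ)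

/-- Domination in the first variable is applied to the inner integral, then domination in the second
variable under the outer one. This is why the definition quantifies over functions and not only over
events. -/
theorem prod {C C' : ℝ≥0∞} {P Q : Measure Ω} {P' Q' : Measure Ω'} [SFinite P'] [SFinite Q']
    (h : SqDominated C P Q) (h' : SqDominated C' P' Q') :
    SqDominated (C * C') (P.prod P') (Q.prod Q') := by
  intro f hf
  rw [lintegral_prod _ hf.aemeasurable, lintegral_prod _ (hf.pow_const 2).aemeasurable]
  calc (∫⁻ x, ∫⁻ y, f (x, y) ∂P' ∂P) ^ 2
      ≤ C * ∫⁻ x, (∫⁻ y, f (x, y) ∂P') ^ 2 ∂Q := h _ hf.lintegral_prod_right'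
    _ ≤ C * ∫⁻ x, C' * ∫⁻ y, f (x, y) ^ 2 ∂Q' ∂Q := by
      gcongr with x
      exact h' _ (hf.comp measurable_prodMk_left)
    _ = C * C' * ∫⁻ x, ∫⁻ y, f (x, y) ^ 2 ∂Q' ∂Q := by
      rw [lintegral_const_mul _ (hf.pow_const 2).lintegral_prod_right', mul_assoc]

theorem sq_measure_le {C : ℝ≥0∞} {P Q : Measure Ω} (h : SqDominated C P Q) {s : Set Ω}
    (hs : MeasurableSet s) : P s ^ 2 ≤ C * Q s := by
  have := h (s.indicator 1) (measurable_one.indicator hs)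
  have h2 : (fun ω => s.indicator (1 : Ω → ℝ≥0∞) ω ^ 2) = s.indicator 1 := by
    ext ω
    by_cases hω : ω ∈ s <;> simp [hω]
  rwa [h2, lintegral_indicator_one hs, lintegral_indicator_one hs] at this

end SqDominated

theorem measurable_update_prod {ι X : Type*} [DecidableEq ι] [MeasurableSpace X] (a : ι) :
    Measurable fun p : X × (ι → X) => Function.update p.2 a p.1 := by
  refine measurable_pi_lambda _ fun j => ?_
  by_cases hj : j = a
  · subst hj
    simpa using measurable_fst
  · simp only [Function.update_of_ne hj]
    fun_prop

/-- Splits off one coordinate, so that an infinite product can be altered one factor at a time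
through `SqDominated.prod`. -/
theorem infinitePi_eq_map_update {ι X : Type*} [DecidableEq ι] [MeasurableSpace X]
    (μ μ' : ι → Measure X) [∀ i, IsProbabilityMeasure (μ i)] [∀ i, IsProbabilityMeasure (μ' i)]
    (a : ι) (h : ∀ j, j ≠ a → μ j = μ' j) :
    Measure.infinitePi μ =
      ((μ a).prod (Measure.infinitePi μ')).map fun p => Function.update p.2 a p.1 := by
  symm
  refine Measure.eq_infinitePi _ fun s t ht => ?_
  rw [Measure.map_apply (measurable_update_prod a) (.pi s.countable_toSet fun _ _ => ht _)]
  have hpre : (fun p : X × (ι → X) => Function.update p.2 a p.1) ⁻¹' (Set.pi s t) =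
      (if a ∈ s then t a else Set.univ) ×ˢ Set.pi (s.erase a : Finset ι) t := by
    ext ⟨x, y⟩
    simp only [Set.mem_preimage, Set.mem_pi, Set.mem_prod, Finset.mem_coe, Finset.mem_erase]
    constructor
    · intro H
      refine ⟨?_, fun j hj => ?_⟩
      · split_ifs with ha
        · simpa using H a ha
        · trivial
      · simpa [Function.update_of_ne hj.1] using H j hj.2
    · rintro ⟨H, H'⟩ j hj
      by_cases hja : j = a
      · subst hja
        simpa [hj] using H
      · simpa [Function.update_of_ne hja] using H' j ⟨hja, hj⟩
  rw [hpre, Measure.prod_prod, Measure.infinitePi_pi _ fun i _ => ht i]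
  have herase : ∏ i ∈ s.erase a, μ' i (t i) = ∏ i ∈ s.erase a, μ i (t i) :=
    Finset.prod_congr rfl fun j hj => by rw [h j (Finset.ne_of_mem_erase hj)]
  rw [herase]
  split_ifs with ha
  · rw [Finset.mul_prod_erase s (fun i => μ i (t i)) ha]
  · rw [Finset.erase_eq_of_notMem ha, measure_univ, one_mul]

theorem SqDominated.infinitePi {ι X : Type*} [DecidableEq ι] [MeasurableSpace X] {C : ℝ≥0∞}
    (s : Finset ι) (μ μ' : ι → Measure X) [∀ i, IsProbabilityMeasure (μ i)]
    [∀ i, IsProbabilityMeasure (μ' i)] (hs : ∀ j, j ∉ s → μ j = μ' j)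
    (h : ∀ j ∈ s, SqDominated C (μ j) (μ' j)) :
    SqDominated (C ^ s.card) (Measure.infinitePi μ) (Measure.infinitePi μ') := by
  induction s using Finset.induction_on generalizing μ with
  | empty =>
    have : μ = μ' := funext fun j => hs j (by simp)
    subst this
    simpa using SqDominated.refl _
  | insert a s ha ih =>
    -- Hybrid product: it already agrees with `μ'` at `a` and still agrees with `μ` everywhere else.
    let ν : ι → Measure X := fun j => if j ∈ s then μ j else μ' j
    have : ∀ j, IsProbabilityMeasure (ν j) := fun j => by
      simp only [ν]; split_ifs <;> infer_instance
    have hν := ih ν (fun j hj => by simp [ν, hj])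
      (fun j hj => by simpa [ν, hj] using h j (Finset.mem_insert_of_mem hj))
    have e1 := infinitePi_eq_map_update μ ν a fun j hj => by
      by_cases hjs : j ∈ s
      · simp [ν, hjs]
      · simpa [ν, hjs] using hs j (by simp [hj, hjs])
    have e2 := infinitePi_eq_map_update μ' μ' a fun _ _ => rfl
    rw [e1, e2, Finset.card_insert_of_notMem ha, pow_succ']
    exact ((h a (Finset.mem_insert_self a s)).prod hν).map (measurable_update_prod a)

/-- Completing the square: `μ` is the midpoint of `ν` and `2μ - ν`, so the geometric mean of the two
outer densities is a multiple of the middle one. -/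
theorem gaussianPDF_eq_sqrt_mul (μ ν x : ℝ) :
    gaussianPDF μ 1 x = ENNReal.ofReal (Real.exp ((μ - ν) ^ 2 / 2)) *
      (ENNReal.ofReal (√(gaussianPDFReal ν 1 x)) *
        ENNReal.ofReal (√(gaussianPDFReal (2 * μ - ν) 1 x))) := by
  rw [← ENNReal.ofReal_mul (Real.sqrt_nonneg _), ← ENNReal.ofReal_mul (Real.exp_nonneg _),
    gaussianPDF, ← Real.sqrt_mul (gaussianPDFReal_nonneg _ _ _)]
  congr 1
  have h0 : 0 ≤ (√(2 * Real.pi * (1 : NNReal)))⁻¹ := by positivity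
  have : gaussianPDFReal ν 1 x * gaussianPDFReal (2 * μ - ν) 1 x =
      ((√(2 * Real.pi * (1 : NNReal)))⁻¹ *
        Real.exp (-((x - μ) ^ 2) / 2 - (μ - ν) ^ 2 / 2)) ^ 2 := by
    simp only [gaussianPDFReal]
    rw [mul_pow, ← Real.exp_nat_mul, mul_mul_mul_comm, ← Real.exp_add]
    congr 1
    · ring
    · congr 1
      push_cast
      ring
  rw [this, Real.sqrt_sq (by positivity), gaussianPDFReal, mul_left_comm, ← Real.exp_add]
  congr 2
  push_cast
  ring

/-- Cauchy–Schwarz applied to the factorization above; the density centred at `2μ - ν` integrates to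
`1`. The constant is one plus the chi-square divergence. -/
theorem sqDominated_gaussianReal (μ ν : ℝ) :
    SqDominated (ENNReal.ofReal (Real.exp ((μ - ν) ^ 2))) (gaussianReal μ 1)
      (gaussianReal ν 1) := by
  intro f hf
  rw [gaussianReal_of_var_ne_zero _ one_ne_zero, gaussianReal_of_var_ne_zero _ one_ne_zero,
    lintegral_withDensity_eq_lintegral_mul _ (measurable_gaussianPDF _ _) hf,
    lintegral_withDensity_eq_lintegral_mul _ (measurable_gaussianPDF _ _) (hf.pow_const 2)]
  have hm : ∀ m : ℝ, Measurable fun x => ENNReal.ofReal (√(gaussianPDFReal m 1 x)) := fun m =>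
    (measurable_gaussianPDFReal m 1).sqrt.ennreal_ofReal
  have hsq : ∀ m x : ℝ, ENNReal.ofReal (√(gaussianPDFReal m 1 x)) ^ 2 = gaussianPDF m 1 x := by
    intro m x
    rw [← ENNReal.ofReal_pow (Real.sqrt_nonneg _), Real.sq_sqrt (gaussianPDFReal_nonneg _ _ _)]
    rfl
  have key := sq_lintegral_mul_le volume (hf.mul (hm ν)) (hm (2 * μ - ν))
  simp only [Pi.mul_apply] at key ⊢
  simp_rw [mul_pow, hsq, lintegral_gaussianPDF_eq_one _ one_ne_zero, one_mul] at key
  calc (∫⁻ x, gaussianPDF μ 1 x * f x) ^ 2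
      = (ENNReal.ofReal (Real.exp ((μ - ν) ^ 2 / 2)) *
          ∫⁻ x, f x * ENNReal.ofReal (√(gaussianPDFReal ν 1 x)) *
            ENNReal.ofReal (√(gaussianPDFReal (2 * μ - ν) 1 x))) ^ 2 := by
        have hmeas : Measurable fun x => f x * ENNReal.ofReal (√(gaussianPDFReal ν 1 x)) *
            ENNReal.ofReal (√(gaussianPDFReal (2 * μ - ν) 1 x)) := (hf.mul (hm ν)).mul (hm _)
        rw [← lintegral_const_mul _ hmeas]
        congr 1
        refine lintegral_congr fun x => ?_
        rw [gaussianPDF_eq_sqrt_mul μ ν x]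
        ring
    _ ≤ ENNReal.ofReal (Real.exp ((μ - ν) ^ 2 / 2)) ^ 2 *
          ∫⁻ x, f x ^ 2 * gaussianPDF ν 1 x := by
        rw [mul_pow]
        gcongr
    _ = _ := by
        have h2 : ((2 : ℕ) : ℝ) * ((μ - ν) ^ 2 / 2) = (μ - ν) ^ 2 := by push_cast; ring
        rw [← ENNReal.ofReal_pow (Real.exp_nonneg _), ← Real.exp_nat_mul, h2]
        congr 1
        exact lintegral_congr fun x => mul_comm _ _

/-! ### Laws of reward tables -/

/-- The law of a table of independent rewards whose row `i` has law `N(m i, 1)`. -/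
noncomputable def tableLaw {n : ℕ} (m : Fin n → ℝ) : Measure (Fin n → ℕ → ℝ) :=
  Measure.pi fun i => Measure.infinitePi fun _ : ℕ => gaussianReal (m i) 1

instance {n : ℕ} (m : Fin n → ℝ) : IsProbabilityMeasure (tableLaw m) := by
  unfold tableLaw; infer_instance

/-- Erase the entries of a row from position `M` on. -/
def truncRow (M : ℕ) (x : ℕ → ℝ) : ℕ → ℝ := fun s => if s < M then x s else 0

/-- Erase the entries of row `i` from position `M` on. -/
def truncTable {n : ℕ} (i : Fin n) (M : ℕ) (X : Fin n → ℕ → ℝ) : Fin n → ℕ → ℝ :=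
  fun j => if j = i then truncRow M (X j) else X j

theorem measurable_truncRow (M : ℕ) : Measurable (truncRow M) := by
  refine measurable_pi_lambda _ fun s => ?_
  by_cases h : s < M <;> simp only [truncRow, h, if_true, if_false] <;> fun_prop

theorem measurable_truncTable {n : ℕ} (i : Fin n) (M : ℕ) : Measurable (truncTable i M) := by
  refine measurable_pi_lambda _ fun j => ?_
  by_cases h : j = i
  · simp only [truncTable, h, if_true]
    exact (measurable_truncRow M).comp (measurable_pi_apply i)
  · simp only [truncTable, h, if_false]
    fun_prop

theorem sqDominated_map_truncRow (μ ν : ℝ) (M : ℕ) :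
    SqDominated (ENNReal.ofReal (Real.exp ((μ - ν) ^ 2)) ^ M)
      ((Measure.infinitePi fun _ : ℕ => gaussianReal μ 1).map (truncRow M))
      ((Measure.infinitePi fun _ : ℕ => gaussianReal ν 1).map (truncRow M)) := by
  have hf : ∀ s : ℕ, Measurable (fun x : ℝ => if s < M then x else 0) := fun s => by
    by_cases h : s < M <;> simp only [h, if_true, if_false] <;> fun_prop
  have h : ∀ m : ℝ, (Measure.infinitePi fun _ : ℕ => gaussianReal m 1).map (truncRow M) =
      Measure.infinitePi fun s : ℕ => (gaussianReal m 1).map fun x => if s < M then x else 0 :=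
    fun m => Measure.infinitePi_map_pi (fun _ : ℕ => gaussianReal m 1) hf
  rw [h, h]
  have : ∀ (m : ℝ) (s : ℕ), IsProbabilityMeasure
      ((gaussianReal m 1).map fun x => if s < M then x else 0) := fun m s =>
    Measure.isProbabilityMeasure_map (hf s).aemeasurable
  have key := SqDominated.infinitePi (C := ENNReal.ofReal (Real.exp ((μ - ν) ^ 2)))
    (Finset.range M)
    (fun s : ℕ => (gaussianReal μ 1).map fun x => if s < M then x else 0)
    (fun s : ℕ => (gaussianReal ν 1).map fun x => if s < M then x else 0)
    (fun s hs => by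
      have : ¬ s < M := by simpa using hs
      simp [this])
    (fun s _ => (sqDominated_gaussianReal μ ν).map (hf s))
  rwa [Finset.card_range] at key

theorem sqDominated_map_truncTable {n : ℕ} (m m' : Fin n → ℝ) (i : Fin n) (M : ℕ)
    (h : ∀ j, j ≠ i → m j = m' j) :
    SqDominated (ENNReal.ofReal (Real.exp ((m i - m' i) ^ 2)) ^ M)
      ((tableLaw m).map (truncTable i M)) ((tableLaw m').map (truncTable i M)) := by
  let φ : Fin n → (ℕ → ℝ) → (ℕ → ℝ) := fun j x => if j = i then truncRow M x else x
  have hφ : ∀ j, Measurable (φ j) := fun j => by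
    by_cases hj : j = i
    · simpa [φ, hj] using measurable_truncRow M
    · simp only [φ, hj, if_false]
      exact measurable_id
  have e : ∀ m : Fin n → ℝ, (tableLaw m).map (truncTable i M) = Measure.infinitePi fun j =>
      (Measure.infinitePi fun _ : ℕ => gaussianReal (m j) 1).map (φ j) := by
    intro m
    rw [tableLaw, ← Measure.infinitePi_eq_pi]
    exact Measure.infinitePi_map_pi _ hφ
  rw [e, e]
  have : ∀ (m : Fin n → ℝ) (j : Fin n), IsProbabilityMeasure
      ((Measure.infinitePi fun _ : ℕ => gaussianReal (m j) 1).map (φ j)) := fun m j =>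
    Measure.isProbabilityMeasure_map (hφ j).aemeasurable
  have key := SqDominated.infinitePi (C := ENNReal.ofReal (Real.exp ((m i - m' i) ^ 2)) ^ M) {i}
    (fun j => (Measure.infinitePi fun _ : ℕ => gaussianReal (m j) 1).map (φ j))
    (fun j => (Measure.infinitePi fun _ : ℕ => gaussianReal (m' j) 1).map (φ j))
    (fun j hj => by rw [h j (by simpa using hj)])
    (fun j hj => by
      obtain rfl : j = i := by simpa using hj
      simpa [φ] using sqDominated_map_truncRow (m j) (m' j) M)
  simpa using key

/-- The event reads only the first `M` entries of row `i`, so both laws may be replaced by their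
truncations, which differ in `M` Gaussian factors. The full row laws have no such finite constant.
-/
theorem sq_measure_le_of_truncTable {n : ℕ} {S : Type*} [MeasurableSpace S] (P : Measure S)
    [IsProbabilityMeasure P] (m m' : Fin n → ℝ) (i : Fin n) (M : ℕ)
    (h : ∀ j, j ≠ i → m j = m' j) {G : Set (S × (Fin n → ℕ → ℝ))} (hG : MeasurableSet G)
    (hinv : ∀ ω, (ω.1, truncTable i M ω.2) ∈ G ↔ ω ∈ G) :
    (P.prod (tableLaw m)) G ^ 2 ≤
      ENNReal.ofReal (Real.exp (M * (m i - m' i) ^ 2)) * (P.prod (tableLaw m')) G := by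
  have hφ := measurable_truncTable i M (n := n)
  have hmap : ∀ m : Fin n → ℝ,
      (P.prod (tableLaw m)) G = (P.prod ((tableLaw m).map (truncTable i M))) G := by
    intro m
    conv_rhs => rw [← Measure.map_id (μ := P)]
    rw [Measure.map_prod_map _ _ measurable_id hφ,
      Measure.map_apply (measurable_id.prodMap hφ) hG]
    congr 1
    ext ω
    exact (hinv ω).symm
  have : ∀ m : Fin n → ℝ, IsProbabilityMeasure ((tableLaw m).map (truncTable i M)) := fun m =>
    Measure.isProbabilityMeasure_map hφ.aemeasurable
  rw [hmap m, hmap m', Real.exp_nat_mul, ENNReal.ofReal_pow (Real.exp_nonneg _)]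
  have := ((SqDominated.refl P).prod (sqDominated_map_truncTable m m' i M h)).sq_measure_le hG
  rwa [one_mul] at this

/-! ### Runs of an algorithm -/

namespace BestArmAlgorithm

variable {n : ℕ} (A : BestArmAlgorithm n)

/-- The number of times arm `i` is played among the first `t` plays. -/
def playCount (i : Fin n) (t : ℕ) (ω : A.Seed × (Fin n → ℕ → ℝ)) : ℕ :=
  (Finset.univ.filter fun k => (A.history ω t k).1 = i).card

/-- The algorithm stops after exactly `t` plays. -/
def FirstStop (t : ℕ) (ω : A.Seed × (Fin n → ℕ → ℝ)) : Prop :=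
  A.StopsAt ω t ∧ ∀ s < t, ¬ A.StopsAt ω s

/-- The arm which the sampling rule plays after `t` plays. -/
def nextArm (t : ℕ) (ω : A.Seed × (Fin n → ℕ → ℝ)) : Fin n :=
  A.sample t (ω.1, A.history ω t)

theorem history_succ (ω : A.Seed × (Fin n → ℕ → ℝ)) (t : ℕ) :
    A.history ω (t + 1) = Fin.snoc (α := fun _ => Fin n × ℝ) (A.history ω t)
      (A.nextArm t ω, ω.2 (A.nextArm t ω) (A.playCount (A.nextArm t ω) t ω)) := rfl

theorem playCount_succ (i : Fin n) (t : ℕ) (ω : A.Seed × (Fin n → ℕ → ℝ)) :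
    A.playCount i (t + 1) ω = A.playCount i t ω + if A.nextArm t ω = i then 1 else 0 := by
  simp only [playCount, Finset.card_filter, Fin.sum_univ_castSucc, history_succ, Fin.snoc_castSucc,
    Fin.snoc_last]

theorem sum_playCount (t : ℕ) (ω : A.Seed × (Fin n → ℕ → ℝ)) :
    ∑ i, A.playCount i t ω = t := by
  simp only [playCount]
  rw [← Finset.card_eq_sum_card_fiberwise (f := fun k => (A.history ω t k).1)
    (t := Finset.univ) (by simp)]
  simp

theorem measurable_history (t : ℕ) : Measurable fun ω => A.history ω t := by
  induction t with
  | zero => exact measurable_of_subsingleton_codomain _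
  | succ t ih =>
    have hnext : Measurable (A.nextArm t) :=
      (A.measurable_sample t).comp (measurable_fst.prodMk ih)
    have hcount : ∀ i, Measurable (A.playCount i t) := by
      intro i
      have : Measurable fun h : Fin t → Fin n × ℝ =>
          (Finset.univ.filter fun k => (h k).1 = i).card := by
        simp only [Finset.card_filter]
        refine Finset.measurable_sum _ fun k _ => ?_
        refine Measurable.ite ?_ measurable_const measurable_const
        exact (measurable_fst.comp (measurable_pi_apply k)) (measurableSet_singleton i)
      exact this.comp ih
    have hread : ∀ i, Measurable fun ω : A.Seed × (Fin n → ℕ → ℝ) =>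
        ω.2 i (A.playCount i t ω) := by
      intro i
      have h1 : Measurable fun p : (ℕ → ℝ) × ℕ => p.1 p.2 :=
        measurable_from_prod_countable_left fun s => measurable_pi_apply s
      have h2 : Measurable fun ω : A.Seed × (Fin n → ℕ → ℝ) => ω.2 i := by fun_prop
      exact h1.comp (h2.prodMk (hcount i))
    have hread' : Measurable fun ω : A.Seed × (Fin n → ℕ → ℝ) =>
        ω.2 (A.nextArm t ω) (A.playCount (A.nextArm t ω) t ω) := by
      have h1 : Measurable fun p : (A.Seed × (Fin n → ℕ → ℝ)) × Fin n =>
          p.1.2 p.2 (A.playCount p.2 t p.1) :=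
        measurable_from_prod_countable_left fun i => hread i
      exact h1.comp (measurable_id.prodMk hnext)
    refine measurable_pi_lambda _ fun k => ?_
    simp only [history_succ]
    refine Fin.lastCases ?_ (fun k => ?_) k
    · simpa only [Fin.snoc_last] using hnext.prodMk hread'
    · simp only [Fin.snoc_castSucc]
      exact (measurable_pi_apply k).comp ih

theorem measurable_playCount (i : Fin n) (t : ℕ) : Measurable (A.playCount i t) := by
  simp only [funext fun ω => show A.playCount i t ω = _ from Finset.card_filter _ _]
  refine Finset.measurable_sum _ fun k _ => ?_
  refine Measurable.ite ?_ measurable_const measurable_const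
  exact (measurable_fst.comp ((measurable_pi_apply k).comp (A.measurable_history t)))
    (measurableSet_singleton i)

theorem measurableSet_stopsAt (t : ℕ) : MeasurableSet {ω | A.StopsAt ω t} :=
  (measurable_fst.prodMk (A.measurable_history t)) (A.measurableSet_stopSet t)

theorem measurableSet_firstStop (t : ℕ) : MeasurableSet {ω | A.FirstStop t ω} := by
  simp only [FirstStop, Set.ofPred_and, Set.ofPred_forall]
  exact (A.measurableSet_stopsAt t).inter
    (.iInter fun s => .iInter fun _ => (A.measurableSet_stopsAt s).compl)

variable {A} in
theorem FirstStop.unique {ω : A.Seed × (Fin n → ℕ → ℝ)} {s t : ℕ} (hs : A.FirstStop s ω)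
    (ht : A.FirstStop t ω) : s = t := by
  rcases lt_trichotomy s t with h | h | h
  · exact absurd hs.1 (ht.2 s h)
  · exact h
  · exact absurd ht.1 (hs.2 t h)

/-- The number of plays of arm `i` before the algorithm stops (and `0` if it never stops). -/
noncomputable def plays (i : Fin n) (ω : A.Seed × (Fin n → ℕ → ℝ)) : ℝ≥0∞ :=
  ∑' t, {ω | A.FirstStop t ω}.indicator (fun ω => (A.playCount i t ω : ℝ≥0∞)) ω

theorem measurable_plays (i : Fin n) : Measurable (A.plays i) :=
  Measurable.tsum fun t =>
    ((measurable_from_top (f := fun k : ℕ => (k : ℝ≥0∞))).comp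
      (A.measurable_playCount i t)).indicator (A.measurableSet_firstStop t)

theorem plays_eq {i : Fin n} {t : ℕ} {ω : A.Seed × (Fin n → ℕ → ℝ)} (h : A.FirstStop t ω) :
    A.plays i ω = A.playCount i t ω := by
  rw [plays, tsum_eq_single t]
  · exact Set.indicator_of_mem (s := {ω | A.FirstStop t ω}) h _
  · intro s hs
    exact Set.indicator_of_notMem (s := {ω | A.FirstStop s ω}) (fun h' => hs (h'.unique h)) _

theorem sum_plays_le_numSamples (ω : A.Seed × (Fin n → ℕ → ℝ)) :
    ∑ i, A.plays i ω ≤ A.numSamples ω := by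
  refine le_iInf₂ fun t ht => ?_
  classical
  have hex : ∃ t, A.StopsAt ω t := ⟨t, ht⟩
  have hfirst : A.FirstStop (Nat.find hex) ω :=
    ⟨Nat.find_spec hex, fun s hs => Nat.find_min hex hs⟩
  simp only [A.plays_eq hfirst]
  rw [← Nat.cast_sum, sum_playCount]
  exact_mod_cast Nat.find_min' hex ht

/-- A run with at most `M` plays of arm `i` never reads an erased entry. The bound may be assumed on
either table, which yields both directions of `truncTable_mem_stopsWith`. -/
theorem history_truncTable (i : Fin n) (M : ℕ) (ω : A.Seed × (Fin n → ℕ → ℝ)) (t : ℕ)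
    (h : A.playCount i t ω ≤ M ∨ A.playCount i t (ω.1, truncTable i M ω.2) ≤ M) :
    A.history (ω.1, truncTable i M ω.2) t = A.history ω t := by
  induction t with
  | zero => rfl
  | succ t ih =>
    have hle : A.history (ω.1, truncTable i M ω.2) t = A.history ω t :=
      ih (h.imp (fun h => le_trans (by rw [playCount_succ]; omega) h)
        (fun h => le_trans (by rw [playCount_succ]; omega) h))
    have hcount : ∀ j, A.playCount j t (ω.1, truncTable i M ω.2) = A.playCount j t ω := fun j => by
      simp only [playCount, hle]
    have hnext : A.nextArm t (ω.1, truncTable i M ω.2) = A.nextArm t ω := by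
      simp only [nextArm, hle]
    rw [history_succ, history_succ, hle, hnext, hcount]
    congr 2
    by_cases hi : A.nextArm t ω = i
    · have hlt : A.playCount i t ω < M := by
        simp only [playCount_succ, hcount, hnext, hi, if_true, or_self] at h
        omega
      simp [truncTable, truncRow, hi, hlt]
    · simp [truncTable, hi]

/-- The algorithm stops, in a situation satisfying `p`, with at most `M` plays of arm `i`. -/
def StopsWith (i : Fin n) (M : ℕ) (p : (t : ℕ) → Set (A.Seed × (Fin t → Fin n × ℝ))) :
    Set (A.Seed × (Fin n → ℕ → ℝ)) :=
  {ω | ∃ t, A.FirstStop t ω ∧ A.playCount i t ω ≤ M ∧ (ω.1, A.history ω t) ∈ p t}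

theorem measurableSet_stopsWith (i : Fin n) (M : ℕ)
    {p : (t : ℕ) → Set (A.Seed × (Fin t → Fin n × ℝ))} (hp : ∀ t, MeasurableSet (p t)) :
    MeasurableSet (A.StopsWith i M p) := by
  simp only [StopsWith, Set.ofPred_exists, Set.ofPred_and]
  refine .iUnion fun t => (A.measurableSet_firstStop t).inter (.inter ?_ ?_)
  · exact (A.measurable_playCount i t) (measurableSet_Iic (a := M))
  · exact (measurable_fst.prodMk (A.measurable_history t)) (hp t)

theorem playCount_mono (i : Fin n) (ω : A.Seed × (Fin n → ℕ → ℝ)) :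
    Monotone fun t => A.playCount i t ω :=
  monotone_nat_of_le_succ fun t => by rw [playCount_succ]; omega

theorem truncTable_mem_stopsWith (i : Fin n) (M : ℕ)
    (p : (t : ℕ) → Set (A.Seed × (Fin t → Fin n × ℝ))) (ω : A.Seed × (Fin n → ℕ → ℝ)) :
    (ω.1, truncTable i M ω.2) ∈ A.StopsWith i M p ↔ ω ∈ A.StopsWith i M p := by
  have key : ∀ t, (A.playCount i t ω ≤ M ∨ A.playCount i t (ω.1, truncTable i M ω.2) ≤ M) →
      ((A.FirstStop t (ω.1, truncTable i M ω.2) ∧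
        A.playCount i t (ω.1, truncTable i M ω.2) ≤ M ∧
        (ω.1, A.history (ω.1, truncTable i M ω.2) t) ∈ p t) ↔
      (A.FirstStop t ω ∧ A.playCount i t ω ≤ M ∧ (ω.1, A.history ω t) ∈ p t)) := by
    intro t ht
    have hh : ∀ s ≤ t, A.history (ω.1, truncTable i M ω.2) s = A.history ω s := fun s hs =>
      A.history_truncTable i M ω s (ht.imp (le_trans (A.playCount_mono i _ hs))
        (le_trans (A.playCount_mono i _ hs)))
    have hsame : ∀ s ≤ t, (A.StopsAt (ω.1, truncTable i M ω.2) s ↔ A.StopsAt ω s) := fun s hs => by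
      simp only [StopsAt, hh s hs]
    have hfirst : A.FirstStop t (ω.1, truncTable i M ω.2) ↔ A.FirstStop t ω := by
      simp only [FirstStop, hsame t le_rfl]
      exact and_congr_right fun _ => forall₂_congr fun s hs => by rw [hsame s hs.le]
    rw [hfirst, hh t le_rfl]
    simp only [playCount, hh t le_rfl]
  constructor
  · rintro ⟨t, h⟩
    exact ⟨t, (key t (.inr h.2.1)).1 h⟩
  · rintro ⟨t, h⟩
    exact ⟨t, (key t (.inl h.2.1)).2 h⟩

theorem sq_stopsWith_le (m m' : Fin n → ℝ) (i : Fin n) (M : ℕ)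
    {p : (t : ℕ) → Set (A.Seed × (Fin t → Fin n × ℝ))} (hp : ∀ t, MeasurableSet (p t))
    (h : ∀ j, j ≠ i → m j = m' j) :
    (A.seedLaw.prod (tableLaw m)) (A.StopsWith i M p) ^ 2 ≤
      ENNReal.ofReal (Real.exp (M * (m i - m' i) ^ 2)) *
        (A.seedLaw.prod (tableLaw m')) (A.StopsWith i M p) :=
  sq_measure_le_of_truncTable A.seedLaw m m' i M h (A.measurableSet_stopsWith i M hp)
    (A.truncTable_mem_stopsWith i M p)

end BestArmAlgorithm

/-! ### Lower bound for one arm -/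

namespace BestArmAlgorithm

variable {n : ℕ} (A : BestArmAlgorithm n)

/-- The law of seed and rewards when the arms have the means `m`. -/
noncomputable def runLaw (m : Fin n → ℝ) : Measure (A.Seed × (Fin n → ℕ → ℝ)) :=
  A.seedLaw.prod (tableLaw m)

instance (m : Fin n → ℝ) : IsProbabilityMeasure (A.runLaw m) := by
  unfold runLaw; infer_instance

theorem sq_real_stopsWith_le (m m' : Fin n → ℝ) (i : Fin n) (M : ℕ)
    {p : (t : ℕ) → Set (A.Seed × (Fin t → Fin n × ℝ))} (hp : ∀ t, MeasurableSet (p t))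
    (h : ∀ j, j ≠ i → m j = m' j) :
    (A.runLaw m).real (A.StopsWith i M p) ^ 2 ≤
      Real.exp (M * (m i - m' i) ^ 2) * (A.runLaw m').real (A.StopsWith i M p) := by
  have key := ENNReal.toReal_mono (ENNReal.mul_ne_top ENNReal.ofReal_ne_top (measure_ne_top _ _))
    (A.sq_stopsWith_le m m' i M hp h)
  rw [ENNReal.toReal_mul, ENNReal.toReal_pow, ENNReal.toReal_ofReal (Real.exp_nonneg _)] at key
  exact key

/-- The situations in which arm `z` is recommended. -/
def recommends (z : Fin n) (t : ℕ) : Set (A.Seed × (Fin t → Fin n × ℝ)) :=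
  {h | A.recommend t h = z}

/-- The situations after more than `a` plays of arm `i`. -/
def playedMoreThan (i : Fin n) (a : ℕ) (t : ℕ) : Set (A.Seed × (Fin t → Fin n × ℝ)) :=
  {h | a < (Finset.univ.filter fun k => (h.2 k).1 = i).card}

theorem measurableSet_recommends (z : Fin n) (t : ℕ) : MeasurableSet (A.recommends z t) :=
  A.measurable_recommend t (measurableSet_singleton z)

theorem measurableSet_playedMoreThan (i : Fin n) (a t : ℕ) :
    MeasurableSet (A.playedMoreThan i a t) := by
  have : Measurable fun h : A.Seed × (Fin t → Fin n × ℝ) =>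
      (Finset.univ.filter fun k => (h.2 k).1 = i).card := by
    simp only [Finset.card_filter]
    refine Finset.measurable_sum _ fun k _ => ?_
    refine Measurable.ite ?_ measurable_const measurable_const
    exact (measurable_fst.comp ((measurable_pi_apply k).comp measurable_snd))
      (measurableSet_singleton i)
  exact this measurableSet_Ioi

/-- The algorithm stops with more than `a` and at most `b` plays of arm `i`. -/
def window (i : Fin n) (a b : ℕ) : Set (A.Seed × (Fin n → ℕ → ℝ)) :=
  A.StopsWith i b (A.playedMoreThan i a)

theorem measurableSet_window (i : Fin n) (a b : ℕ) : MeasurableSet (A.window i a b) :=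
  A.measurableSet_stopsWith i b (A.measurableSet_playedMoreThan i a)

theorem disjoint_window (i : Fin n) {a b a' b' : ℕ} (h : b ≤ a') :
    Disjoint (A.window i a b) (A.window i a' b') := by
  rw [Set.disjoint_left]
  rintro ω ⟨t, ht, hb, -⟩ ⟨t', ht', -, ha⟩
  obtain rfl := ht.unique ht'
  have : a' < A.playCount i t ω := ha
  omega

theorem real_stopsWith_recommends_le {δ : ℝ} (hA : A.IsCorrect δ) (I : BestArmInstance n)
    {i z : Fin n} (hi : I.IsBest i) (hiz : z ≠ i) (M : ℕ) :
    (A.runLaw I.mean).real (A.StopsWith i M (A.recommends z)) ≤ δ := by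
  have hdisj : Disjoint {ω | A.Returns ω i} (A.StopsWith i M (A.recommends z)) := by
    rw [Set.disjoint_left]
    rintro ω ⟨t, h1, h2, h3⟩ ⟨t', ht', -, h⟩
    obtain rfl := FirstStop.unique ⟨h1, h2⟩ ht'
    exact hiz (h.symm.trans h3)
  have hsum := measureReal_union (μ := A.runLaw I.mean) hdisj
    (A.measurableSet_stopsWith i M (A.measurableSet_recommends z))
  have hle : (A.runLaw I.mean).real
      ({ω | A.Returns ω i} ∪ A.StopsWith i M (A.recommends z)) ≤ 1 := measureReal_le_one
  have hret : 1 - δ ≤ (A.runLaw I.mean).real {ω | A.Returns ω i} :=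
    (ENNReal.ofReal_le_iff_le_toReal (measure_ne_top _ _)).1 (hA I i hi)
  linarith

/-- Splits a run that answers `z` by its number of plays of `i`: few (refuted by changing the
instance), intermediate, or many (bounded by Markov's inequality). -/
theorem returns_subset (i z : Fin n) (a b : ℕ) :
    {ω | A.Returns ω z} ⊆ A.StopsWith i a (A.recommends z) ∪ A.window i a b ∪
      {ω | (b : ℝ≥0∞) ≤ A.plays i ω} := by
  rintro ω ⟨t, h1, h2, h3⟩
  have ht : A.FirstStop t ω := ⟨h1, h2⟩
  rcases le_or_gt (A.playCount i t ω) a with ha | ha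
  · exact .inl (.inl ⟨t, ht, ha, h3⟩)
  · rcases le_or_gt (A.playCount i t ω) b with hb | hb
    · exact .inl (.inr ⟨t, ht, hb, ha⟩)
    · refine .inr ?_
      simp only [Set.mem_ofPred_eq, A.plays_eq ht]
      exact_mod_cast hb.le

/-- If the instances `I` and `I'` differ only in arm `i`, which is the best arm of `I'` but not
of `I`, then on `I` either arm `i` is played often or its number of plays lies in a window with
large probability. -/
theorem half_le_real_window {δ : ℝ} (hA : A.IsCorrect δ) (hδ : δ ≤ 0.005)
    (I I' : BestArmInstance n) {i z : Fin n} (hz : I.IsBest z) (hi : I'.IsBest i) (hiz : z ≠ i)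
    (hII' : ∀ j, j ≠ i → I.mean j = I'.mean j) {a b : ℕ}
    (ha : a * (I.mean i - I'.mean i) ^ 2 ≤ 1) (hb : 0 < b) {e : ℝ} (he0 : 0 ≤ e)
    (he : ∫⁻ ω, A.plays i ω ∂A.runLaw I.mean ≤ ENNReal.ofReal e) (heb : e ≤ b / 4) :
    1 / 2 ≤ (A.runLaw I.mean).real (A.window i a b) := by
  set P := A.runLaw I.mean
  have hret : 1 - δ ≤ P.real {ω | A.Returns ω z} :=
    (ENNReal.ofReal_le_iff_le_toReal (measure_ne_top _ _)).1 (hA I z hz)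
  have hsub := (measureReal_mono (μ := P) (A.returns_subset i z a b)).trans
    ((measureReal_union_le _ _).trans (add_le_add (measureReal_union_le _ _) le_rfl))
  -- On `I'` the answer `z` is wrong, and the change of measure costs a factor `e`: `√(0.005 e) <
  -- 0.12`. The final count is `0.995 - 0.12 - 0.25 ≥ 1/2`.
  have hV : P.real (A.StopsWith i a (A.recommends z)) ≤ 0.12 := by
    have h1 := A.sq_real_stopsWith_le I.mean I'.mean i a (A.measurableSet_recommends z) hII'
    have h2 := A.real_stopsWith_recommends_le hA I' hi hiz a
    have h3 : Real.exp (a * (I.mean i - I'.mean i) ^ 2) ≤ 2.7182818286 :=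
      (Real.exp_le_exp.2 ha).trans Real.exp_one_lt_d9.le
    have h4 : P.real (A.StopsWith i a (A.recommends z)) ^ 2 ≤ 2.7182818286 * 0.005 :=
      h1.trans (mul_le_mul h3 (h2.trans hδ) measureReal_nonneg (by norm_num))
    exact (pow_le_pow_iff_left₀ measureReal_nonneg (by norm_num) two_ne_zero).1
      (h4.trans (by norm_num))
  have hN : P.real {ω | (b : ℝ≥0∞) ≤ A.plays i ω} ≤ 1 / 4 := by
    have h1 := (mul_meas_ge_le_lintegral (μ := P) (A.measurable_plays i) (b : ℝ≥0∞)).trans he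
    have h2 := ENNReal.toReal_mono ENNReal.ofReal_ne_top h1
    rw [ENNReal.toReal_mul, ENNReal.toReal_ofReal he0, ENNReal.toReal_natCast] at h2
    have h3 : (b : ℝ) * P.real {ω | (b : ℝ≥0∞) ≤ A.plays i ω} ≤ b / 4 := h2.trans heb
    have hb' : (0 : ℝ) < b := by exact_mod_cast hb
    by_contra! hcon
    nlinarith
  linarith

end BestArmAlgorithm

/-- The instance whose best arm `z` has mean `1/2`, with the gaps `g`. -/
noncomputable def gapInstance {n : ℕ} (z : Fin n) (g : Fin n → ℝ) (hz : g z = 0)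
    (hg : ∀ i, i ≠ z → g i ∈ Set.Ioc 0 (1 / 2)) : BestArmInstance n where
  mean i := 1 / 2 - g i
  mean_mem i := by
    by_cases hi : i = z
    · subst hi
      norm_num [hz]
    · have := hg i hi
      constructor <;> linarith [this.1, this.2]
  exists_best := ⟨z, fun i hi => by linarith [(hg i hi).1]⟩

namespace BestArmAlgorithm

variable {n : ℕ} (A : BestArmAlgorithm n)

/-- The gap of arm `i` is changed twice: from `γ` to `-γ`, which makes `i` the best arm and forces
it to be played, and from `γ` to `0`, which reaches a law not depending on `γ`. -/
theorem exp_le_real_window {δ : ℝ} (hA : A.IsCorrect δ) (hδ : δ ≤ 0.005) {z i : Fin n}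
    (hiz : i ≠ z) (g : Fin n → ℝ) (hz : g z = 0) (hg : ∀ j, j ≠ z → g j ∈ Set.Ioc 0 (1 / 2))
    {x : ℝ} {γ : ℝ} (hγ : γ ∈ Set.Ioc 0 (1 / 2)) (hxγ : x * γ ^ 2 = 1)
    {a b : ℕ} {β : ℝ} (hax : 4 * a ≤ x) (hbx : b = β * x) (hb : 0 < b) {e : ℝ} (he0 : 0 ≤ e)
    (he : ∫⁻ ω, A.plays i ω ∂A.runLaw (fun j => 1 / 2 - Function.update g i γ j) ≤
      ENNReal.ofReal e) (heb : e ≤ b / 4) :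
    Real.exp (-β) / 4 ≤
      (A.runLaw fun j => 1 / 2 - Function.update g i 0 j).real (A.window i a b) := by
  have hmem : ∀ j, j ≠ z → Function.update g i γ j ∈ Set.Ioc 0 (1 / 2) := fun j hj => by
    by_cases hji : j = i
    · subst hji
      simpa using hγ
    · simpa [hji] using hg j hj
  let I : BestArmInstance n := gapInstance z (Function.update g i γ) (by simp [hiz.symm, hz]) hmem
  have hz' : I.IsBest z := fun j hj => by
    have h1 : Function.update g i γ z = 0 := by simp [hiz.symm, hz]
    have := (hmem j hj).1
    simp only [I, gapInstance, h1]
    linarith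
  have hg0 : ∀ j, 0 ≤ g j ∧ g j ≤ 1 / 2 := fun j => by
    by_cases hj : j = z
    · subst hj
      norm_num [hz]
    · exact ⟨(hg j hj).1.le, (hg j hj).2⟩
  have hbest : ∀ j, j ≠ i →
      1 / 2 - Function.update g i (-γ) j < 1 / 2 - Function.update g i (-γ) i := fun j hj => by
    simp only [Function.update_self, Function.update_of_ne hj]
    linarith [(hg0 j).1, hγ.1]
  let I' : BestArmInstance n :=
    { mean := fun j => 1 / 2 - Function.update g i (-γ) j
      mean_mem := fun j => by
        by_cases hj : j = i
        · subst hj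
          simp only [Function.update_self]
          constructor <;> linarith [hγ.1, hγ.2]
        · simp only [Function.update_of_ne hj]
          constructor <;> linarith [(hg0 j).1, (hg0 j).2]
      exists_best := ⟨i, hbest⟩ }
  -- The means of `i` in `I` and `I'` differ by `2γ`, hence the requirement `4 * a ≤ x`.
  have hhalf := A.half_le_real_window hA hδ I I' hz' (i := i) hbest hiz.symm
    (fun j hj => by simp [I, I', gapInstance, hj]) (a := a) (b := b)
    (by
      simp only [I, I', gapInstance, Function.update_self]
      nlinarith [sq_nonneg γ]) hb he0 he heb
  -- With gap `0` the arms `i` and `z` tie, so this mean vector is not an instance. Only the law of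
  -- the run is used, not correctness.
  have hsq := A.sq_real_stopsWith_le I.mean (fun j => 1 / 2 - Function.update g i 0 j) i b
    (A.measurableSet_playedMoreThan i a) (fun j hj => by simp [I, gapInstance, hj])
  have hexp : (b : ℝ) * (I.mean i - (1 / 2 - Function.update g i 0 i)) ^ 2 = β := by
    simp only [I, gapInstance, Function.update_self]
    rw [hbx]
    linear_combination β * hxγ
  rw [hexp] at hsq
  have h4 : 1 / 4 ≤ Real.exp β *
      (A.runLaw fun j => 1 / 2 - Function.update g i 0 j).real (A.window i a b) :=
    le_trans ((by norm_num : (1 / 4 : ℝ) = (1 / 2) ^ 2).le.trans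
      (pow_le_pow_left₀ (by norm_num) hhalf 2)) hsq
  calc Real.exp (-β) / 4 = Real.exp (-β) * (1 / 4) := by ring
    _ ≤ Real.exp (-β) * (Real.exp β *
      (A.runLaw fun j => 1 / 2 - Function.update g i 0 j).real (A.window i a b)) := by gcongr
    _ = _ := by rw [← mul_assoc, ← Real.exp_add]; simp

/-- Averaged over the scales `j < J` of the gap of arm `i`, the expected number of plays of that
arm exceeds the squared inverse gap by a factor of order `β`. -/
theorem sum_plays_ge {δ : ℝ} (hA : A.IsCorrect δ) (hδ : δ ≤ 0.005) {z i : Fin n}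
    (hiz : i ≠ z) (g : Fin n → ℝ) (hz : g z = 0) (hg : ∀ j, j ≠ z → g j ∈ Set.Ioc 0 (1 / 2))
    {β D J : ℕ} (hβ : 0 < β) (hD : 2 ≤ D) (hβD : 4 * β ≤ D ^ 2) (hJ : 8 * Real.exp β ≤ J)
    (e : ℕ → ℝ) (he0 : ∀ j, 0 ≤ e j)
    (he : ∀ j < J, ∫⁻ ω, A.plays i ω ∂A.runLaw
      (fun k => 1 / 2 - Function.update g i ((D : ℝ) ^ (j + 1))⁻¹ k) ≤ ENNReal.ofReal (e j)) :
    J * (β / 8 : ℝ) ≤ ∑ j ∈ Finset.range J, (((D : ℝ) ^ (j + 1)) ^ 2)⁻¹ * e j := by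
  have hD0 : (0 : ℝ) < D := by positivity
  -- At scale `j`, with `x = D ^ (2 (j + 1))`, the upper end is `b (j + 1) = β x`, and the lower end
  -- satisfies `4 * b j ≤ x` because `4 * β ≤ D ^ 2`. Consecutive windows thus abut without overlap.
  let b : ℕ → ℕ := fun j => β * (D ^ j) ^ 2
  set Q := A.runLaw fun k => 1 / 2 - Function.update g i 0 k
  let good : Finset ℕ := (Finset.range J).filter fun j => e j ≤ (b (j + 1) : ℝ) / 4
  have hwin : ∀ j ∈ good, Real.exp (-β) / 4 ≤ Q.real (A.window i (b j) (b (j + 1))) := by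
    intro j hj
    obtain ⟨hjJ, hej⟩ := Finset.mem_filter.1 hj
    have hpow : (2 : ℝ) ≤ (D : ℝ) ^ (j + 1) := by
      calc (2 : ℝ) ≤ D := by exact_mod_cast hD
        _ = (D : ℝ) ^ 1 := (pow_one _).symm
        _ ≤ (D : ℝ) ^ (j + 1) :=
          pow_le_pow_right₀ (by exact_mod_cast (by omega : 1 ≤ D)) (by omega)
    refine A.exp_le_real_window hA hδ hiz g hz hg (x := ((D : ℝ) ^ (j + 1)) ^ 2)
      (γ := ((D : ℝ) ^ (j + 1))⁻¹) ⟨by positivity, ?_⟩ (by field_simp) ?_ ?_ ?_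
      (he0 j) (he j (Finset.mem_range.1 hjJ)) hej
    · rw [one_div]
      exact inv_anti₀ two_pos hpow
    · have h1 : (4 * β : ℝ) ≤ (D : ℝ) ^ 2 := by exact_mod_cast hβD
      have h2 : (0 : ℝ) ≤ ((D : ℝ) ^ j) ^ 2 := by positivity
      simp only [b]
      push_cast
      calc (4 * (β * ((D : ℝ) ^ j) ^ 2) : ℝ) = 4 * β * ((D : ℝ) ^ j) ^ 2 := by ring
        _ ≤ (D : ℝ) ^ 2 * ((D : ℝ) ^ j) ^ 2 := by gcongr
        _ = _ := by ring
    · simp [b]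
    · positivity
  have hcard : (good.card : ℝ) ≤ 4 * Real.exp β := by
    have hdisj : (good : Set ℕ).PairwiseDisjoint fun j => A.window i (b j) (b (j + 1)) := by
      have hmono : Monotone b := fun j k hjk => by
        simp only [b]
        gcongr
        omega
      intro j _ k _ hjk
      rcases lt_or_gt_of_ne hjk with h | h
      · exact A.disjoint_window i (hmono h)
      · exact (A.disjoint_window i (hmono h)).symm
    have h1 := measureReal_biUnion_finset (μ := Q) hdisj
      fun j _ => A.measurableSet_window i (b j) (b (j + 1))
    have h2 : ∑ j ∈ good, Q.real (A.window i (b j) (b (j + 1))) ≤ 1 :=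
      h1 ▸ measureReal_le_one
    have h3 := (Finset.sum_le_sum hwin).trans h2
    rw [Finset.sum_const, nsmul_eq_mul, Real.exp_neg] at h3
    have h4 := Real.exp_pos (β : ℝ)
    field_simp at h3
    linarith
  let bad : Finset ℕ := (Finset.range J).filter fun j => ¬ e j ≤ (b (j + 1) : ℝ) / 4
  have hcards : (good.card : ℝ) + bad.card = J := by
    have := Finset.card_filter_add_card_filter_not (s := Finset.range J)
      (fun j => e j ≤ (b (j + 1) : ℝ) / 4)
    rw [Finset.card_range] at this
    exact_mod_cast this
  have hβ0 : (0 : ℝ) < β := by exact_mod_cast hβ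
  -- At most `4 exp β ≤ J / 2` scales are good, so at least `J / 2` are bad.
  calc (J : ℝ) * (β / 8) ≤ bad.card * (β / 4 : ℝ) := by nlinarith
    _ = ∑ j ∈ bad, (β / 4 : ℝ) := by rw [Finset.sum_const, nsmul_eq_mul]
    _ ≤ ∑ j ∈ bad, (((D : ℝ) ^ (j + 1)) ^ 2)⁻¹ * e j := by
      refine Finset.sum_le_sum fun j hj => ?_
      have hj' := not_le.1 (Finset.mem_filter.1 hj).2
      have hpos : (0 : ℝ) < ((D : ℝ) ^ (j + 1)) ^ 2 := by positivity
      rw [inv_mul_eq_div, le_div_iff₀ hpos]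
      simp only [b] at hj'
      push_cast at hj'
      linarith
    _ ≤ _ := Finset.sum_le_sum_of_subset_of_nonneg (Finset.filter_subset _ _)
      fun j _ _ => mul_nonneg (by positivity) (he0 j)

end BestArmAlgorithm

/-! ### Averaging over random gaps -/

/-- Exchanging `κ i` with `j` is an involution of the pairs `(κ, j)`. -/
theorem sum_sum_update {ι α : Type*} [Fintype ι] [DecidableEq ι] [Fintype α] [DecidableEq α]
    (i : ι) (F : (ι → α) → ℝ) :
    ∑ κ, ∑ j, F (Function.update κ i j) = Fintype.card α * ∑ κ, F κ := by
  let swap : (ι → α) × α → (ι → α) × α := fun p => (Function.update p.1 i p.2, p.1 i)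
  have hinv : Function.Involutive swap := by
    rintro ⟨κ, j⟩
    simp [swap]
  rw [← Fintype.sum_prod_type' fun κ j => F (Function.update κ i j)]
  have h := Equiv.sum_comp (Function.Involutive.toPerm swap hinv) fun p : (ι → α) × α => F p.1
  have h' : ∀ p : (ι → α) × α,
      (Function.Involutive.toPerm swap hinv p).1 = Function.update p.1 i p.2 :=
    fun _ => rfl
  simp only [h'] at h
  rw [h, Fintype.sum_prod_type' fun (κ : ι → α) (_ : α) => F κ, Finset.mul_sum]
  simp

/-- If every `κ` failed, so would the average with the product weights `∏ (x (κ i))⁻¹`. Under these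
weights, resampling coordinate `i` alone gives exactly the sums bounded in the hypothesis. -/
theorem exists_sum_le_of_forall_resample {ι α : Type*} [Fintype ι] [DecidableEq ι] [Fintype α]
    [DecidableEq α] [Nonempty α] (s : Finset ι) (x : α → ℝ) (hx : ∀ j, 0 < x j)
    (N : (ι → α) → ι → ℝ) (c : ℝ)
    (h : ∀ i ∈ s, ∀ κ, Fintype.card α * c ≤ ∑ j, (x j)⁻¹ * N (Function.update κ i j) i) :
    ∃ κ, c * ∑ i ∈ s, x (κ i) ≤ ∑ i ∈ s, N κ i := by
  by_contra! hcon
  let w : (ι → α) → ℝ := fun κ => ∏ i, (x (κ i))⁻¹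
  have hw : ∀ κ, 0 < w κ := fun κ => Finset.prod_pos fun i _ => inv_pos.2 (hx _)
  have hlt : ∑ κ, w κ * ∑ i ∈ s, N κ i < ∑ κ, w κ * (c * ∑ i ∈ s, x (κ i)) :=
    Finset.sum_lt_sum_of_nonempty Finset.univ_nonempty fun κ _ =>
      mul_lt_mul_of_pos_left (hcon κ) (hw κ)
  have hge : ∀ i ∈ s, ∑ κ, w κ * (c * x (κ i)) ≤ ∑ κ, w κ * N κ i := by
    intro i hi
    -- The weight without its factor at `i` is unchanged by resampling `i`, and `w κ * x (κ i) = v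
    -- κ`.
    let v : (ι → α) → ℝ := fun κ => ∏ k ∈ Finset.univ.erase i, (x (κ k))⁻¹
    have hv : ∀ κ, 0 < v κ := fun κ => Finset.prod_pos fun k _ => inv_pos.2 (hx _)
    have hwv : ∀ κ, w κ = (x (κ i))⁻¹ * v κ := fun κ =>
      (Finset.mul_prod_erase Finset.univ (fun k => (x (κ k))⁻¹) (Finset.mem_univ i)).symm
    have hvu : ∀ κ j, v (Function.update κ i j) = v κ := fun κ j =>
      Finset.prod_congr rfl fun k hk => by
        rw [Function.update_of_ne (Finset.ne_of_mem_erase hk)]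
    have hcard : (0 : ℝ) < Fintype.card α := by exact_mod_cast Fintype.card_pos
    refine le_of_mul_le_mul_left ?_ hcard
    rw [← sum_sum_update i fun κ => w κ * N κ i, Finset.mul_sum]
    refine Finset.sum_le_sum fun κ _ => ?_
    have hxi := (hx (κ i)).ne'
    calc (Fintype.card α : ℝ) * (w κ * (c * x (κ i))) = v κ * (Fintype.card α * c) := by
          rw [hwv]; field_simp
      _ ≤ v κ * ∑ j, (x j)⁻¹ * N (Function.update κ i j) i :=
          mul_le_mul_of_nonneg_left (h i hi κ) (hv κ).le
      _ = ∑ j, w (Function.update κ i j) * N (Function.update κ i j) i := by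
          rw [Finset.mul_sum]
          refine Finset.sum_congr rfl fun j _ => ?_
          rw [hwv, hvu, Function.update_self]
          ring
  refine absurd hlt (not_lt.2 ?_)
  simp only [Finset.mul_sum]
  rw [Finset.sum_comm, Finset.sum_comm (s := Finset.univ) (t := s)]
  exact Finset.sum_le_sum hge

/-! ### Ordered gaps -/

namespace BestArmInstance

variable {n : ℕ} (I : BestArmInstance n)

theorem sort_last {z : Fin n} (hz : I.IsBest z) (hn : n - 1 < n) :
    Tuple.sort I.mean ⟨n - 1, hn⟩ = z := by
  by_contra hne
  have h1 := hz _ hne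
  obtain ⟨k, hk⟩ := (Tuple.sort I.mean).surjective z
  have h2 := Tuple.monotone_sort I.mean (show k ≤ ⟨n - 1, hn⟩ from Nat.le_sub_one_of_lt k.2)
  simp only [Function.comp_apply, hk] at h2
  linarith

theorem gap_eq {z : Fin n} (hz : I.IsBest z) {i : ℕ} (hi : 1 ≤ i ∧ i ≤ n) :
    I.gap i = I.mean z - I.mean (Tuple.sort I.mean ⟨n - i, by omega⟩) := by
  have h1 : 1 ≤ 1 ∧ 1 ≤ n := ⟨le_rfl, hi.1.trans hi.2⟩
  rw [gap, orderedMean, orderedMean, dif_pos h1, dif_pos hi, I.sort_last hz]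

theorem sort_ne {z : Fin n} (hz : I.IsBest z) {i : ℕ} (hi : 2 ≤ i ∧ i ≤ n) :
    Tuple.sort I.mean ⟨n - i, by omega⟩ ≠ z := by
  rw [← I.sort_last hz (by omega)]
  intro h
  have := congrArg Fin.val ((Tuple.sort I.mean).injective h)
  simp only at this
  omega

/-- Sorting permutes the arms and puts the strict maximum `z` last, so positions `2, …, n` from the
top enumerate the other arms. -/
theorem sum_gap {z : Fin n} (hz : I.IsBest z) (f : ℝ → ℝ) :
    ∑ i ∈ Finset.Icc 2 n, f (I.gap i) =
      ∑ k ∈ Finset.univ.erase z, f (I.mean z - I.mean k) := by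
  refine Finset.sum_bij (fun i hi => Tuple.sort I.mean ⟨n - i, by
    have := Finset.mem_Icc.1 hi; omega⟩) ?_ ?_ ?_ ?_
  · intro i hi
    exact Finset.mem_erase.2 ⟨I.sort_ne hz (Finset.mem_Icc.1 hi), Finset.mem_univ _⟩
  · intro i hi j hj h
    have := congrArg Fin.val ((Tuple.sort I.mean).injective h)
    have hi' := Finset.mem_Icc.1 hi
    have hj' := Finset.mem_Icc.1 hj
    simp only at this
    omega
  · intro k hk
    obtain ⟨l, hl⟩ := (Tuple.sort I.mean).surjective k
    have hl2 : (l : ℕ) ≠ n - 1 := by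
      intro h
      have hl' : l = ⟨n - 1, by omega⟩ := Fin.ext h
      rw [hl', I.sort_last hz] at hl
      exact Finset.ne_of_mem_erase hk hl.symm
    have := l.2
    refine ⟨n - l, Finset.mem_Icc.2 ⟨by omega, by omega⟩, ?_⟩
    rw [← hl]
    congr 1
    ext
    simp only
    omega
  · intro i hi
    have := Finset.mem_Icc.1 hi
    rw [I.gap_eq hz ⟨by omega, this.2⟩]

end BestArmInstance

/-! ### Instances with geometric gaps -/

/-- The gaps `0` for arm `z` and `D ^ -(κ i + 1)` for the other arms `i`. -/
noncomputable def geomGap {n J : ℕ} (D : ℕ) (z : Fin n) (κ : Fin n → Fin J) (i : Fin n) : ℝ :=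
  if i = z then 0 else ((D : ℝ) ^ ((κ i : ℕ) + 1))⁻¹

theorem geomGap_self {n J : ℕ} (D : ℕ) (z : Fin n) (κ : Fin n → Fin J) :
    geomGap D z κ z = 0 := if_pos rfl

theorem geomGap_of_ne {n J : ℕ} (D : ℕ) {z i : Fin n} (hi : i ≠ z) (κ : Fin n → Fin J) :
    geomGap D z κ i = ((D : ℝ) ^ ((κ i : ℕ) + 1))⁻¹ := if_neg hi

theorem two_le_pow_succ {D : ℕ} (hD : 2 ≤ D) (j : ℕ) : (2 : ℝ) ≤ (D : ℝ) ^ (j + 1) := by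
  exact_mod_cast hD.trans (Nat.le_self_pow (Nat.succ_ne_zero j) D)

theorem geomGap_mem {n J : ℕ} {D : ℕ} (hD : 2 ≤ D) {z : Fin n} (κ : Fin n → Fin J) (i : Fin n)
    (hi : i ≠ z) : geomGap D z κ i ∈ Set.Ioc (0 : ℝ) (1 / 2) := by
  rw [geomGap_of_ne D hi, one_div]
  have h := two_le_pow_succ hD (κ i)
  exact ⟨by positivity, inv_anti₀ two_pos h⟩

theorem geomGap_update {n J : ℕ} (D : ℕ) {z i : Fin n} (hi : i ≠ z) (κ : Fin n → Fin J)
    (j : Fin J) : geomGap D z (Function.update κ i j) =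
      Function.update (geomGap D z κ) i ((D : ℝ) ^ ((j : ℕ) + 1))⁻¹ := by
  ext k
  by_cases hk : k = i
  · subst hk
    simp [geomGap, hi]
  · simp [geomGap, hk]

/-- The instance with geometric gaps. -/
noncomputable def geomInstance {n J : ℕ} {D : ℕ} (hD : 2 ≤ D) (z : Fin n) (κ : Fin n → Fin J) :
    BestArmInstance n :=
  gapInstance z (geomGap D z κ) (geomGap_self D z κ) (geomGap_mem hD κ)

theorem geomInstance_mean {n J : ℕ} {D : ℕ} (hD : 2 ≤ D) (z : Fin n) (κ : Fin n → Fin J) :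
    (geomInstance hD z κ).mean = fun i => 1 / 2 - geomGap D z κ i := rfl

theorem geomInstance_isBest {n J : ℕ} {D : ℕ} (hD : 2 ≤ D) (z : Fin n) (κ : Fin n → Fin J) :
    (geomInstance hD z κ).IsBest z := fun i hi => by
  simp only [geomInstance_mean, geomGap_self]
  linarith [(geomGap_mem hD κ i hi).1]

theorem geomInstance_mean_sub {n J : ℕ} {D : ℕ} (hD : 2 ≤ D) {z : Fin n} (κ : Fin n → Fin J)
    {i : Fin n} (hi : i ≠ z) :
    (geomInstance hD z κ).mean z - (geomInstance hD z κ).mean i =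
      ((D : ℝ) ^ ((κ i : ℕ) + 1))⁻¹ := by
  simp only [geomInstance_mean, geomGap_self, geomGap_of_ne D hi]
  ring

namespace BestArmAlgorithm

variable {n : ℕ} (A : BestArmAlgorithm n)

theorem sum_lintegral_plays_le (I : BestArmInstance n) :
    ∑ i, ∫⁻ ω, A.plays i ω ∂A.runLaw I.mean ≤ A.expectedSamples I := by
  rw [← lintegral_finsetSum _ fun i _ => A.measurable_plays i]
  exact lintegral_mono A.sum_plays_le_numSamples

theorem exists_geomInstance_le {δ : ℝ} (hA : A.IsCorrect δ) (hδ : δ ≤ 0.005) (z : Fin n)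
    {β D J : ℕ} (hβ : 0 < β) (hD : 2 ≤ D) (hβD : 4 * β ≤ D ^ 2) (hJ : 8 * Real.exp β ≤ J) :
    ∃ κ : Fin n → Fin J,
      ENNReal.ofReal (β / 8 * ∑ i ∈ Finset.univ.erase z, ((D : ℝ) ^ ((κ i : ℕ) + 1)) ^ 2) ≤
        A.expectedSamples (geomInstance hD z κ) := by
  -- An infinite expectation settles the claim at once; otherwise all expected play counts are
  -- finite and the averaging can be done in `ℝ`.
  by_cases htop : ∃ κ : Fin n → Fin J, A.expectedSamples (geomInstance hD z κ) = ⊤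
  · obtain ⟨κ, hκ⟩ := htop
    exact ⟨κ, hκ ▸ le_top⟩
  push Not at htop
  let E : (Fin n → Fin J) → Fin n → ℝ≥0∞ := fun κ i =>
    ∫⁻ ω, A.plays i ω ∂A.runLaw (geomInstance hD z κ).mean
  have hE : ∀ κ i, E κ i ≠ ⊤ := fun κ i =>
    ((Finset.single_le_sum (f := E κ) (fun _ _ => zero_le) (Finset.mem_univ i)).trans
      (A.sum_lintegral_plays_le _)).trans_lt (lt_top_iff_ne_top.2 (htop κ)) |>.ne
  have hJ0 : 0 < J := by
    have : (0 : ℝ) < J := lt_of_lt_of_le (by positivity) hJ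
    exact_mod_cast this
  have : Nonempty (Fin J) := ⟨⟨0, hJ0⟩⟩
  have hD0 : (0 : ℝ) < D := by positivity
  obtain ⟨κ, hκ⟩ := exists_sum_le_of_forall_resample (Finset.univ.erase z)
    (fun j : Fin J => ((D : ℝ) ^ ((j : ℕ) + 1)) ^ 2) (fun j => by positivity)
    (fun κ i => (E κ i).toReal) (β / 8) (by
      intro i hi κ
      have hiz := Finset.ne_of_mem_erase hi
      let e : ℕ → ℝ := fun j => if h : j < J then (E (Function.update κ i ⟨j, h⟩) i).toReal else 0
      have key := A.sum_plays_ge hA hδ hiz (geomGap D z κ) (geomGap_self D z κ)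
        (geomGap_mem hD κ) hβ hD hβD hJ e
        (fun j => by simp only [e]; split_ifs <;> simp)
        (fun j hj => by
          simp only [e, hj, dif_pos, ENNReal.ofReal_toReal (hE _ _)]
          simp only [E, geomInstance_mean, geomGap_update D hiz]
          exact le_rfl)
      rw [Fintype.card_fin]
      refine key.trans (le_of_eq ?_)
      rw [← Fin.sum_univ_eq_sum_range (fun j => (((D : ℝ) ^ (j + 1)) ^ 2)⁻¹ * e j) J]
      refine Finset.sum_congr rfl fun j _ => ?_
      simp only [e, j.2, dif_pos])
  refine ⟨κ, (ENNReal.ofReal_le_ofReal hκ).trans ?_⟩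
  rw [← ENNReal.toReal_sum fun i _ => hE κ i]
  refine ENNReal.ofReal_toReal_le.trans ((Finset.sum_le_sum_of_subset
    (Finset.erase_subset _ _)).trans (A.sum_lintegral_plays_le _))

end BestArmAlgorithm

/-! ### Choice of the parameters -/

/-- In logarithms, `2 J log (2β) ≤ 32 · 6 ^ β ≤ 384 ^ β / 2`, and `384 ≤ exp 8` gives `384 ^ β ≤ exp
(8β) ≤ log x`. -/
theorem pow_scale_le_sqrt {β J j : ℕ} {x : ℝ} (hβ : 0 < β)
    (hx : 8 * (β : ℝ) ≤ Real.log (Real.log x))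
    (hlog : 0 < Real.log x) (hx0 : 0 < x) (hJ : J = 8 * 3 ^ β) (hj : j < J) :
    (((2 * β : ℕ) : ℝ) ^ (j + 1)) ^ 2 ≤ √x := by
  have hb1 : (1 : ℝ) ≤ β := by exact_mod_cast hβ
  have h384 : (384 : ℝ) ^ β ≤ Real.log x := by
    calc (384 : ℝ) ^ β ≤ (Real.exp 8) ^ β := by
          gcongr
          calc (384 : ℝ) ≤ 2.7 ^ 8 := by norm_num
            _ ≤ Real.exp 1 ^ 8 := by
              gcongr
              exact le_trans (by norm_num) Real.exp_one_gt_d9.le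
            _ = Real.exp 8 := by rw [← Real.exp_nat_mul]; norm_num
      _ = Real.exp (8 * β) := by rw [← Real.exp_nat_mul, mul_comm]
      _ ≤ Real.log x := (Real.le_log_iff_exp_le hlog).1 hx
  have hlogD : Real.log ((2 * β : ℕ) : ℝ) ≤ 2 * 2 ^ β := by
    have h1 : Real.log ((2 * β : ℕ) : ℝ) ≤ (2 * β : ℕ) := Real.log_le_self (by positivity)
    have h2 : ((β : ℕ) : ℝ) ≤ 2 ^ β := by exact_mod_cast (Nat.lt_two_pow_self (n := β)).le
    push_cast at h1 ⊢
    linarith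
  have h1D : (1 : ℝ) ≤ ((2 * β : ℕ) : ℝ) := by push_cast; linarith
  have h64 : (64 : ℝ) ≤ 64 ^ β := by
    calc (64 : ℝ) = 64 ^ 1 := (pow_one _).symm
      _ ≤ 64 ^ β := pow_le_pow_right₀ (by norm_num) hβ
  have hpos : (0 : ℝ) < ((2 * β : ℕ) : ℝ) := by linarith
  rw [← pow_mul]
  refine (pow_le_pow_right₀ h1D (show (j + 1) * 2 ≤ J * 2 by omega)).trans ?_
  rw [← Real.exp_log (pow_pos hpos (J * 2)), ← Real.exp_log (Real.sqrt_pos.2 hx0),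
    Real.log_pow, Real.log_sqrt hx0.le]
  refine Real.exp_le_exp.2 ?_
  rw [hJ]
  push_cast
  push_cast at hlogD
  calc 8 * 3 ^ β * 2 * Real.log (2 * β) ≤ 8 * 3 ^ β * 2 * (2 * 2 ^ β) := by gcongr
    _ = 64 * 6 ^ β / 2 := by
      rw [show (6 : ℝ) = 3 * 2 by norm_num, mul_pow]; ring
    _ ≤ 64 ^ β * 6 ^ β / 2 := by gcongr
    _ = 384 ^ β / 2 := by rw [← mul_pow]; norm_num
    _ ≤ Real.log x / 2 := by gcongr

theorem sqrt_mul_log_lt {x : ℝ} (hx : 2 ≤ x) : √x * Real.log x < 4 * (x - 1) := by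
  have hx0 : 0 < x := by linarith
  have h2 : Real.log x ≤ 2 * (√x - 1) := by
    have := Real.log_le_sub_one_of_pos (Real.sqrt_pos.2 hx0)
    rw [Real.log_sqrt hx0.le] at this
    linarith
  have h3 := Real.sq_sqrt hx0.le
  have h4 : 1 ≤ √x := Real.one_le_sqrt.2 (by linarith)
  nlinarith [mul_le_mul_of_nonneg_left h2 (Real.sqrt_nonneg x)]

theorem mainTheorem2 :
    ∃ (c c₁ : ℝ) (N : ℕ), 0 < c ∧ 0 < c₁ ∧
      ∀ δ : ℝ, 0 < δ → δ < 0.005 → ∀ n : ℕ, N ≤ n →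
        ∀ A : BestArmAlgorithm n, A.IsCorrect δ →
          ∃ I : BestArmInstance n,
            ENNReal.ofReal
                (c * ∑ i ∈ Finset.Icc 2 n, (I.gap i ^ 2)⁻¹ * Real.log (Real.log n)) ≤
              A.expectedSamples I ∧
            I.gap 2 < 1 ∧
            (I.gap 2 ^ 2)⁻¹ * Real.log (Real.log (I.gap 2)⁻¹) <
              c₁ / Real.log n *
                ∑ i ∈ Finset.Icc 2 n, (I.gap i ^ 2)⁻¹ * Real.log (Real.log n) := by
  have hlim : Filter.Tendsto (fun n : ℕ => Real.log (Real.log n)) Filter.atTop Filter.atTop :=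
    Real.tendsto_log_atTop.comp (Real.tendsto_log_atTop.comp tendsto_natCast_atTop_atTop)
  -- From `ℓ ≥ 16` follows `⌊ℓ / 8⌋ ≥ ℓ / 16`, whence the constant `1 / 128 = (1 / 16) · (1 / 8)`.
  obtain ⟨N, hN⟩ := Filter.eventually_atTop.1 (hlim.eventually_ge_atTop 16)
  refine ⟨1 / 128, 1, max N 2, by norm_num, one_pos, fun δ _ hδ n hn A hA => ?_⟩
  have hn2 : 2 ≤ n := (le_max_right _ _).trans hn
  have hl := hN n ((le_max_left _ _).trans hn)
  set ℓ := Real.log (Real.log n) with hℓ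
  have hn2' : (2 : ℝ) ≤ n := by exact_mod_cast hn2
  have hlog : 0 < Real.log n := Real.log_pos (by linarith)
  let z : Fin n := ⟨0, by omega⟩
  let β : ℕ := ⌊ℓ / 8⌋₊
  have hβ1 : (β : ℝ) ≤ ℓ / 8 := Nat.floor_le (by linarith)
  have hβ2 : ℓ / 8 < β + 1 := Nat.lt_floor_add_one _
  have hβ : 0 < β := Nat.floor_pos.2 (by linarith)
  have hD : 2 ≤ 2 * β := by omega
  -- The number of scales is `J = 8 * 3 ^ β`, an integer above `8 * exp β` because `e < 3`; the
  -- ratio is `D = 2 * β`, so that `4 * β ≤ D ^ 2`.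
  have hJ : 8 * Real.exp β ≤ ((8 * 3 ^ β : ℕ) : ℝ) := by
    push_cast
    have h3 : Real.exp 1 ≤ 3 := Real.exp_one_lt_d9.le.trans (by norm_num)
    have : Real.exp β = Real.exp 1 ^ β := by rw [← Real.exp_nat_mul, mul_one]
    rw [this]
    gcongr
  obtain ⟨κ, hκ⟩ := A.exists_geomInstance_le hA hδ.le z hβ hD (by nlinarith) hJ
  let I := geomInstance hD z κ
  have hI : I.IsBest z := geomInstance_isBest hD z κ
  have hsum : ∑ i ∈ Finset.Icc 2 n, (I.gap i ^ 2)⁻¹ * ℓ =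
      (∑ i ∈ Finset.univ.erase z, (((2 * β : ℕ) : ℝ) ^ ((κ i : ℕ) + 1)) ^ 2) * ℓ := by
    rw [I.sum_gap hI fun t => (t ^ 2)⁻¹ * ℓ, Finset.sum_mul]
    refine Finset.sum_congr rfl fun i hi => ?_
    rw [geomInstance_mean_sub hD κ (Finset.ne_of_mem_erase hi), inv_pow, inv_inv]
  set H := ∑ i ∈ Finset.univ.erase z, (((2 * β : ℕ) : ℝ) ^ ((κ i : ℕ) + 1)) ^ 2
  have hHn : 4 * ((n : ℝ) - 1) ≤ H := by
    have h1 := Finset.card_nsmul_le_sum (Finset.univ.erase z)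
      (fun i => (((2 * β : ℕ) : ℝ) ^ ((κ i : ℕ) + 1)) ^ 2) 4 fun i _ => by
        nlinarith [two_le_pow_succ hD (κ i)]
    rw [Finset.card_erase_of_mem (Finset.mem_univ z), Finset.card_univ, Fintype.card_fin,
      nsmul_eq_mul, Nat.cast_sub (by omega), Nat.cast_one] at h1
    linarith
  have hgap : I.gap 2 = (((2 * β : ℕ) : ℝ) ^
      ((κ (Tuple.sort I.mean ⟨n - 2, by omega⟩) : ℕ) + 1))⁻¹ := by
    rw [I.gap_eq hI ⟨one_le_two, hn2⟩]
    exact geomInstance_mean_sub hD κ (I.sort_ne hI ⟨le_rfl, hn2⟩)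
  refine ⟨I, ?_, ?_, ?_⟩
  · rw [hsum]
    refine (ENNReal.ofReal_le_ofReal ?_).trans hκ
    have hH0 : 0 ≤ H := by linarith
    have : ℓ / 128 ≤ β / 8 := by linarith
    calc 1 / 128 * (H * ℓ) = ℓ / 128 * H := by ring
      _ ≤ β / 8 * H := by gcongr
  · rw [hgap]
    exact inv_lt_one_of_one_lt₀ (one_lt_two.trans_le (two_le_pow_succ hD _))
  · rw [hsum, hgap, inv_inv, inv_pow, inv_inv]
    set j := κ (Tuple.sort I.mean ⟨n - 2, by omega⟩)
    set y := ((2 * β : ℕ) : ℝ) ^ ((j : ℕ) + 1)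
    have hy2 : 2 ≤ y := two_le_pow_succ hD j
    have hy : y ^ 2 ≤ √n :=
      pow_scale_le_sqrt hβ (by rw [← hℓ]; linarith) hlog (by linarith) rfl j.2
    have hyn : y ≤ n := by
      have h1 : √(n : ℝ) ≤ n := by
        rw [Real.sqrt_le_left (by linarith)]; nlinarith
      nlinarith
    have hlly : Real.log (Real.log y) ≤ ℓ :=
      Real.log_le_log (Real.log_pos (by linarith)) (Real.log_le_log (by linarith) hyn)
    -- One gap contributes at most `√n` to `H`, whereas `H ≥ 4 (n - 1)` since each squared inverse
    -- gap is at least `4`.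
    have hmain : √(n : ℝ) < H / Real.log n := by
      rw [lt_div_iff₀ hlog]
      exact (sqrt_mul_log_lt hn2').trans_le hHn
    calc y ^ 2 * Real.log (Real.log y) ≤ y ^ 2 * ℓ := by gcongr
      _ ≤ √n * ℓ := by gcongr
      _ < H / Real.log n * ℓ := by gcongr
      _ = 1 / Real.log n * (H * ℓ) := by ring
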